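/- **Theorem 3.3.** Let $H$ be a separable complex Hilbert space, $B$ a bounded self-adjoint operator on $H$ with $\|B\|<1/9$, and $A=e^{iB}$ (a unitary operator). Assume that $\phi\in H$ is a unit vector which is cyclic for $A$, i.e. $\{P(A,A^*)\phi : P\in\mathbb C[X,Y]\}$ is dense in $H$. For $N\in\mathbb N$ let $H_N$, $H_N^-$ and $H_N^+$ be the linear spans of the vectors $A^i(A^*)^j\phi$ with, respectively, $i,j\le N$; $i<N$, $j\le N$; and $0<i\le N$, $j\le N$. Let $W_N^-$ and $W_N^+$ be the orthogonal complements of $H_N^-$ and $H_N^+$ in $H_N$, let $U_N:W_N^-\to W_N^+$ be any surjective linear isometry, and let $A_N$ be the linear operator on $H_N$ with $A_N v=Av$ for $v\in H_N^-$ and $A_Nv=U_Nv$ for $v\in W_N^-$. Let $(u_N(n))_{n<\dim H_N}$ be any orthonormal basis of $H_N$ consisting of eigenvectors of $A_N$, with eigenvalues $\lambda_N(n)$, and let $B_N$ be the linear operator on $H_N$ with $B_N u_N(n)=q\,u_N(n)$, where $q\in\,]-\pi,\pi]$ is the argument of $\lambda_N(n)$ (that is, $\lambda_N(n)=e^{iq}$).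 Let $D$ be an ultrafilter on $\mathbb N$ that contains, for every integer $m\ge1$, the set of all $N\ge1$ such that $\sqrt N$ is an integer divisible by $m$. Let $H^m$ be the metric ultraproduct of the spaces $H_N$ along $D$: the sequences $(v_N)_N\in\prod_N H_N$ that are norm-bounded on a set in $D$, modulo those with $\lim_D\|v_N\|=0$, with inner product $\lim_D\langle v_N|w_N\rangle$. Let $B^m$ be the operator on $H^m$ that maps the class of $(v_N)_N$ to the class of $(B_Nv_N)_N$ (it is well defined and bounded, since $\|B_N\|\le\pi$ for all $N$). Let $G^m:H\to H^m$ be the unique linear isometric embedding that maps $P(A,A^*)\phi$, for every $P\in\mathbb C[X,Y]$, to the class of any sequence whose $N$-th member is $P(A,A^*)\phi$ for $D$-almost all $N$ (note that $P(A,A^*)\phi\in H_N$ for all large $N$), and let $H^{Im}$ be the range of $G^m$. Then $H^{Im}$ is closed under $B^m$, and $$B^m\restriction H^{Im}=G^m\,B\,(G^m)^{-1}$$ as operators on $H^{Im}$. -/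

import Mathlib

open Filter Topology
open scoped InnerProductSpace

noncomputable section

/-! ### Metric ultraproducts of inner product spaces -/

section MetricUltraproduct

variable (D : Ultrafilter ℕ) (E : ℕ → Type*) [∀ N, NormedAddCommGroup (E N)]
  [∀ N, InnerProductSpace ℂ (E N)]

/-- The sequences `(v_N)` in the product of the spaces `E N` which represent an element of finite
norm of the ultraproduct: the norms are bounded by one real number for `D`-almost all `N`. -/
def FiniteSeq : Submodule ℂ (∀ N, E N) where
  carrier := {v | ∃ C : ℝ, ∀ᶠ N in (D : Filter ℕ), ‖v N‖ ≤ C}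
  add_mem' := by
    rintro v w ⟨C, hC⟩ ⟨K, hK⟩
    refine ⟨C + K, ?_⟩
    filter_upwards [hC, hK] with N h1 h2
    exact (norm_add_le _ _).trans (add_le_add h1 h2)
  zero_mem' := ⟨0, by simp⟩
  smul_mem' := by
    rintro c v ⟨C, hC⟩
    refine ⟨‖c‖ * C, ?_⟩
    filter_upwards [hC] with N h1
    simpa [norm_smul] using mul_le_mul_of_nonneg_left h1 (norm_nonneg c)

/-- The sequences whose norm is infinitesimal in the ultraproduct: for every `ε > 0` the norm is
smaller than `ε` for `D`-almost all `N`. -/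
def NullSeq : Submodule ℂ (FiniteSeq D E) where
  carrier := {v | ∀ ε : ℝ, 0 < ε → ∀ᶠ N in (D : Filter ℕ), ‖v.1 N‖ < ε}
  add_mem' := by
    intro v w hv hw ε hε
    filter_upwards [hv (ε / 2) (half_pos hε), hw (ε / 2) (half_pos hε)] with N h1 h2
    calc ‖v.1 N + w.1 N‖ ≤ ‖v.1 N‖ + ‖w.1 N‖ := norm_add_le _ _
      _ < ε := by linarith
  zero_mem' := by
    intro ε hε
    simp [hε]
  smul_mem' := by
    intro c v hv ε hε
    filter_upwards [hv (ε / (‖c‖ + 1)) (by positivity)] with N h1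
    change ‖c • v.1 N‖ < ε
    rw [norm_smul]
    rw [lt_div_iff₀ (by positivity)] at h1
    nlinarith [norm_nonneg c, norm_nonneg (v.1 N)]

/-- The metric ultraproduct: elements of finite norm modulo being infinitely close.
(Sequences that agree for `D`-almost all `N` are in particular infinitely close, so that the
passage to the algebraic ultraproduct is included.) -/
def MetricUltraproduct : Type _ := FiniteSeq D E ⧸ NullSeq D E

namespace MetricUltraproduct

instance : AddCommGroup (MetricUltraproduct D E) :=
  inferInstanceAs (AddCommGroup (FiniteSeq D E ⧸ NullSeq D E))

instance : Module ℂ (MetricUltraproduct D E) :=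
  inferInstanceAs (Module ℂ (FiniteSeq D E ⧸ NullSeq D E))

/-- The class of a sequence of finite norm. -/
def mk : FiniteSeq D E →ₗ[ℂ] MetricUltraproduct D E := (NullSeq D E).mkQ

variable {D E}

lemma mk_surjective : Function.Surjective (mk D E) := Submodule.mkQ_surjective _

lemma mk_eq_mk {v w : FiniteSeq D E} : mk D E v = mk D E w ↔ v - w ∈ NullSeq D E :=
  Submodule.Quotient.eq _

lemma mem_nullSeq_iff {v : FiniteSeq D E} :
    v ∈ NullSeq D E ↔ Tendsto (fun N => ‖v.1 N‖) (D : Filter ℕ) (𝓝 0) := by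
  rw [tendsto_order]
  constructor
  · intro h
    exact ⟨fun a ha => Eventually.of_forall fun N => ha.trans_le (norm_nonneg _), h⟩
  · intro h
    exact h.2

lemma exists_tendsto {f : ℕ → ℂ} (h : ∃ C : ℝ, ∀ᶠ N in (D : Filter ℕ), ‖f N‖ ≤ C) :
    ∃ z, Tendsto f (D : Filter ℕ) (𝓝 z) := by
  obtain ⟨C, hC⟩ := h
  have := (isCompact_closedBall (0 : ℂ) C).ultrafilter_le_nhds (D.map f) (by
    rw [le_principal_iff]
    change f ⁻¹' _ ∈ (D : Filter ℕ)
    filter_upwards [hC] with N hN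
    simpa using hN)
  obtain ⟨z, -, hz⟩ := this
  exact ⟨z, hz⟩

lemma exists_tendsto_inner (v w : FiniteSeq D E) :
    ∃ z, Tendsto (fun N => ⟪v.1 N, w.1 N⟫_ℂ) (D : Filter ℕ) (𝓝 z) := by
  obtain ⟨C, hC⟩ := v.2
  obtain ⟨K, hK⟩ := w.2
  refine exists_tendsto ⟨C * K, ?_⟩
  filter_upwards [hC, hK] with N h1 h2
  exact (norm_inner_le_norm _ _).trans
    (mul_le_mul h1 h2 (norm_nonneg _) ((norm_nonneg _).trans h1))

/-- The `D`-limit of the inner products of two sequences. -/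
def seqInner (v w : FiniteSeq D E) : ℂ := limUnder (D : Filter ℕ) fun N => ⟪v.1 N, w.1 N⟫_ℂ

lemma tendsto_seqInner (v w : FiniteSeq D E) :
    Tendsto (fun N => ⟪v.1 N, w.1 N⟫_ℂ) (D : Filter ℕ) (𝓝 (seqInner v w)) :=
  tendsto_nhds_limUnder (exists_tendsto_inner v w)

lemma seqInner_eq {v w : FiniteSeq D E} {z : ℂ}
    (h : Tendsto (fun N => ⟪v.1 N, w.1 N⟫_ℂ) (D : Filter ℕ) (𝓝 z)) : seqInner v w = z :=
  tendsto_nhds_unique (tendsto_seqInner v w) h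

lemma seqInner_add_left (v v' w : FiniteSeq D E) :
    seqInner (v + v') w = seqInner v w + seqInner v' w := by
  apply seqInner_eq
  refine ((tendsto_seqInner v w).add (tendsto_seqInner v' w)).congr fun N => ?_
  exact (inner_add_left _ _ _).symm

lemma seqInner_smul_left (c : ℂ) (v w : FiniteSeq D E) :
    seqInner (c • v) w = (starRingEnd ℂ) c * seqInner v w := by
  apply seqInner_eq
  refine ((tendsto_seqInner v w).const_mul ((starRingEnd ℂ) c)).congr fun N => ?_
  exact (inner_smul_left _ _ _).symm

lemma seqInner_conj_symm (v w : FiniteSeq D E) :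
    (starRingEnd ℂ) (seqInner w v) = seqInner v w := by
  refine (seqInner_eq ?_).symm
  refine ((Complex.continuous_conj.tendsto _).comp (tendsto_seqInner w v)).congr fun N => ?_
  exact inner_conj_symm _ _

lemma seqInner_null_left {v : FiniteSeq D E} (hv : v ∈ NullSeq D E) (w : FiniteSeq D E) :
    seqInner v w = 0 := by
  apply seqInner_eq
  obtain ⟨K, hK⟩ := w.2
  have h0 : Tendsto (fun N => ‖v.1 N‖ * K) (D : Filter ℕ) (𝓝 0) := by
    simpa using (mem_nullSeq_iff.1 hv).mul_const K
  refine squeeze_zero_norm' ?_ h0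
  filter_upwards [hK] with N hN
  exact (norm_inner_le_norm _ _).trans (mul_le_mul_of_nonneg_left hN (norm_nonneg _))

lemma seqInner_null_right {w : FiniteSeq D E} (hw : w ∈ NullSeq D E) (v : FiniteSeq D E) :
    seqInner v w = 0 := by
  rw [← seqInner_conj_symm, seqInner_null_left hw, map_zero]

lemma seqInner_add_right (v w w' : FiniteSeq D E) :
    seqInner v (w + w') = seqInner v w + seqInner v w' := by
  rw [← seqInner_conj_symm, seqInner_add_left, map_add, seqInner_conj_symm, seqInner_conj_symm]

lemma seqInner_congr {v v' w w' : FiniteSeq D E} (hv : v - v' ∈ NullSeq D E)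
    (hw : w - w' ∈ NullSeq D E) : seqInner v w = seqInner v' w' := by
  have e1 : seqInner v w = seqInner v' w := by
    conv_lhs => rw [← sub_add_cancel v v', seqInner_add_left, seqInner_null_left hv, zero_add]
  have e2 : seqInner v' w = seqInner v' w' := by
    conv_lhs => rw [← sub_add_cancel w w', seqInner_add_right, seqInner_null_right hw, zero_add]
  rw [e1, e2]

/-- The inner product of the metric ultraproduct: the `D`-limit of the inner products. -/
def inner' (x y : MetricUltraproduct D E) : ℂ :=
  Quotient.liftOn₂' x y seqInner fun _ _ _ _ h1 h2 =>
    seqInner_congr ((Submodule.quotientRel_def _).1 h1) ((Submodule.quotientRel_def _).1 h2)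

lemma inner'_mk (v w : FiniteSeq D E) : inner' (mk D E v) (mk D E w) = seqInner v w := rfl

lemma tendsto_norm_sq (v : FiniteSeq D E) :
    Tendsto (fun N => ‖v.1 N‖ ^ 2) (D : Filter ℕ) (𝓝 (seqInner v v).re) := by
  refine ((Complex.continuous_re.tendsto _).comp (tendsto_seqInner v v)).congr fun N => ?_
  exact inner_self_eq_norm_sq (𝕜 := ℂ) (v.1 N)

variable (D E) in
/-- The `D`-limit of the inner products is an inner product on the metric ultraproduct. -/
@[reducible] def innerCore : InnerProductSpace.Core ℂ (MetricUltraproduct D E) where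
  inner := inner'
  conj_inner_symm x y := by
    obtain ⟨v, rfl⟩ := mk_surjective x
    obtain ⟨w, rfl⟩ := mk_surjective y
    exact seqInner_conj_symm v w
  re_inner_nonneg x := by
    obtain ⟨v, rfl⟩ := mk_surjective x
    exact ge_of_tendsto' (tendsto_norm_sq v) fun N => by positivity
  add_left x y z := by
    obtain ⟨v, rfl⟩ := mk_surjective x
    obtain ⟨w, rfl⟩ := mk_surjective y
    obtain ⟨t, rfl⟩ := mk_surjective z
    exact seqInner_add_left v w t
  smul_left x y c := by
    obtain ⟨v, rfl⟩ := mk_surjective x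
    obtain ⟨w, rfl⟩ := mk_surjective y
    exact seqInner_smul_left c v w
  definite x hx := by
    obtain ⟨v, rfl⟩ := mk_surjective x
    have h := tendsto_norm_sq v
    rw [show seqInner v v = 0 from hx, Complex.zero_re] at h
    have h' : Tendsto (fun N => ‖v.1 N‖) (D : Filter ℕ) (𝓝 0) := by
      have h2 := (Real.continuous_sqrt.tendsto 0).comp h
      rw [Real.sqrt_zero] at h2
      exact h2.congr fun N => Real.sqrt_sq (norm_nonneg _)
    exact (Submodule.Quotient.mk_eq_zero _).2 (mem_nullSeq_iff.2 h')

instance : NormedAddCommGroup (MetricUltraproduct D E) := (innerCore D E).toNormedAddCommGroup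

instance : InnerProductSpace ℂ (MetricUltraproduct D E) :=
  InnerProductSpace.ofCore (innerCore D E).toCore

lemma inner_mk (v w : FiniteSeq D E) : ⟪mk D E v, mk D E w⟫_ℂ = seqInner v w := rfl

/-- The norm of the metric ultraproduct is the `D`-limit of the norms. -/
lemma tendsto_norm (v : FiniteSeq D E) :
    Tendsto (fun N => ‖v.1 N‖) (D : Filter ℕ) (𝓝 ‖mk D E v‖) := by
  have h := (Real.continuous_sqrt.tendsto _).comp (tendsto_norm_sq v)
  have e : ‖mk D E v‖ = Real.sqrt (seqInner v v).re := rfl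
  rw [e]
  refine h.congr fun N => ?_
  simp [Real.sqrt_sq]

/-- The metric ultraproduct of a uniformly bounded sequence of operators. It maps the class of
`(v_N)` to the class of `(T_N v_N)`. -/
def map (T : ∀ N, E N →ₗ[ℂ] E N) (hT : ∃ C : ℝ, ∀ N x, ‖T N x‖ ≤ C * ‖x‖) :
    MetricUltraproduct D E →L[ℂ] MetricUltraproduct D E :=
  have bdd : ∀ v ∈ FiniteSeq D E, (LinearMap.pi fun N => T N ∘ₗ LinearMap.proj N) v ∈
      FiniteSeq D E := by
    rintro v ⟨K, hK⟩
    obtain ⟨C, hC⟩ := hT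
    refine ⟨|C| * K, ?_⟩
    filter_upwards [hK] with N hN
    calc ‖T N (v N)‖ ≤ C * ‖v N‖ := hC N _
      _ ≤ |C| * ‖v N‖ := mul_le_mul_of_nonneg_right (le_abs_self C) (norm_nonneg _)
      _ ≤ |C| * K := mul_le_mul_of_nonneg_left hN (abs_nonneg C)
  have null : NullSeq D E ≤
      (NullSeq D E).comap ((LinearMap.pi fun N => T N ∘ₗ LinearMap.proj N).restrict bdd) := by
    intro v hv
    obtain ⟨C, hC⟩ := hT
    rw [Submodule.mem_comap, mem_nullSeq_iff]
    have h0 : Tendsto (fun N => C * ‖v.1 N‖) (D : Filter ℕ) (𝓝 0) := by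
      simpa using (mem_nullSeq_iff.1 hv).const_mul C
    exact squeeze_zero (fun N => norm_nonneg _) (fun N => hC N _) h0
  LinearMap.mkContinuousOfExistsBound
    ((NullSeq D E).mapQ (NullSeq D E)
      ((LinearMap.pi fun N => T N ∘ₗ LinearMap.proj N).restrict bdd) null)
    (by
      obtain ⟨C, hC⟩ := hT
      refine ⟨C, fun x => ?_⟩
      obtain ⟨v, rfl⟩ := mk_surjective x
      exact le_of_tendsto_of_tendsto'
        (tendsto_norm ((LinearMap.pi fun N => T N ∘ₗ LinearMap.proj N).restrict bdd v))
        ((tendsto_norm v).const_mul C) fun N => hC N _)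

lemma map_mk (T : ∀ N, E N →ₗ[ℂ] E N) (hT : ∃ C : ℝ, ∀ N x, ‖T N x‖ ≤ C * ‖x‖)
    (v w : FiniteSeq D E) (h : ∀ N, w.1 N = T N (v.1 N)) :
    map T hT (mk D E v) = mk D E w := by
  refine mk_eq_mk.2 (mem_nullSeq_iff.2 ?_)
  have h0 (N : ℕ) : T N (v.1 N) - w.1 N = 0 := by rw [h N, sub_self]
  refine tendsto_const_nhds.congr fun N => ?_
  exact (norm_eq_zero.2 (h0 N)).symm

end MetricUltraproduct

end MetricUltraproduct

/-! ### Finite dimensional approximations of a unitary operator -/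

section Approximation

variable {H : Type*} [NormedAddCommGroup H] [InnerProductSpace ℂ H] [CompleteSpace H]

/-- The operator `P(A, A*)` for a polynomial `P(X, Y)`, with `X = X 0` and `Y = X 1`. -/
def polyOp (A : H →L[ℂ] H) (P : MvPolynomial (Fin 2) ℂ) : H →L[ℂ] H :=
  ∑ m ∈ P.support, P.coeff m • (A ^ m 0 * (ContinuousLinearMap.adjoint A) ^ m 1)

/-- `φ` is cyclic for `A`: the vectors `P(A, A*) φ` are dense. -/
def IsCyclicVector (A : H →L[ℂ] H) (φ : H) : Prop :=
  Dense (Set.range fun P : MvPolynomial (Fin 2) ℂ => polyOp A P φ)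

/-- The span of the vectors `A^i (A*)^j φ` with `(i, j) ∈ s`. -/
def genSpan (A : H →L[ℂ] H) (φ : H) (s : Finset (ℕ × ℕ)) : Submodule ℂ H :=
  Submodule.span ℂ
    ((fun p : ℕ × ℕ => (A ^ p.1 * (ContinuousLinearMap.adjoint A) ^ p.2) φ) '' (s : Set (ℕ × ℕ)))

instance (A : H →L[ℂ] H) (φ : H) (s : Finset (ℕ × ℕ)) : FiniteDimensional ℂ (genSpan A φ s) :=
  FiniteDimensional.span_of_finite ℂ (s.finite_toSet.image _)

/-- `H_N`, generated by `A^i (A*)^j φ` with `i, j ≤ N`. -/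
abbrev approxSpace (A : H →L[ℂ] H) (φ : H) (N : ℕ) : Submodule ℂ H :=
  genSpan A φ (Finset.Iic N ×ˢ Finset.Iic N)

/-- `H_N⁻`, generated by `A^i (A*)^j φ` with `i < N`, `j ≤ N`. -/
abbrev approxSpaceMinus (A : H →L[ℂ] H) (φ : H) (N : ℕ) : Submodule ℂ H :=
  genSpan A φ (Finset.Iio N ×ˢ Finset.Iic N)

/-- `H_N⁺`, generated by `A^i (A*)^j φ` with `0 < i ≤ N`, `j ≤ N`. -/
abbrev approxSpacePlus (A : H →L[ℂ] H) (φ : H) (N : ℕ) : Submodule ℂ H :=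
  genSpan A φ (Finset.Ioc 0 N ×ˢ Finset.Iic N)

/-- `W⁻`, the orthogonal complement of `H_N⁻` in `H_N`. -/
abbrev complMinus (A : H →L[ℂ] H) (φ : H) (N : ℕ) : Submodule ℂ H :=
  (approxSpaceMinus A φ N)ᗮ ⊓ approxSpace A φ N

/-- `W⁺`, the orthogonal complement of `H_N⁺` in `H_N`. -/
abbrev complPlus (A : H →L[ℂ] H) (φ : H) (N : ℕ) : Submodule ℂ H :=
  (approxSpacePlus A φ N)ᗮ ⊓ approxSpace A φ N

lemma genSpan_mono (A : H →L[ℂ] H) (φ : H) {s t : Finset (ℕ × ℕ)} (h : s ⊆ t) :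
    genSpan A φ s ≤ genSpan A φ t :=
  Submodule.span_mono (Set.image_mono (Finset.coe_subset.2 h))

lemma apply_mem_approxSpace (A : H →L[ℂ] H) (φ : H) (N : ℕ) {x : H}
    (hx : x ∈ approxSpaceMinus A φ N) : A x ∈ approxSpace A φ N := by
  have : approxSpaceMinus A φ N ≤ (approxSpace A φ N).comap (A : H →ₗ[ℂ] H) := by
    refine Submodule.span_le.2 ?_
    rintro _ ⟨⟨i, j⟩, hij, rfl⟩
    refine Submodule.subset_span ⟨(i + 1, j), ?_, ?_⟩
    · simp only [Finset.coe_product, Set.mem_prod, Finset.coe_Iio, Finset.coe_Iic, Set.mem_Iio,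
        Set.mem_Iic] at hij ⊢
      omega
    · simp [pow_succ']
  exact this hx

/-- The approximation `A_N` of a unitary operator `A` on `H_N` given by a unitary map `U` from `W⁻`
onto `W⁺`: it is `A` on `H_N⁻` and `U` on `W⁻`. -/
def approxOp (A : H →L[ℂ] H) (φ : H) (N : ℕ)
    (U : complMinus A φ N ≃ₗᵢ[ℂ] complPlus A φ N) :
    approxSpace A φ N →ₗ[ℂ] approxSpace A φ N :=
  LinearMap.codRestrict (approxSpace A φ N)
    (((A : H →ₗ[ℂ] H) ∘ₗ ((approxSpaceMinus A φ N).starProjection : H →ₗ[ℂ] H) +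
      (complPlus A φ N).subtype ∘ₗ (U.toLinearEquiv : _ →ₗ[ℂ] _) ∘ₗ
        ((complMinus A φ N).orthogonalProjectionOnto : H →ₗ[ℂ] complMinus A φ N)) ∘ₗ
      (approxSpace A φ N).subtype)
    (fun x => by
      refine Submodule.add_mem _ (apply_mem_approxSpace A φ N ?_) ?_
      · exact Submodule.starProjection_apply_mem _ _
      · exact (Submodule.mem_inf.1 (Subtype.mem _)).2)

lemma approxOp_apply_of_mem_minus (A : H →L[ℂ] H) (φ : H) (N : ℕ)
    (U : complMinus A φ N ≃ₗᵢ[ℂ] complPlus A φ N) (x : approxSpace A φ N)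
    (hx : (x : H) ∈ approxSpaceMinus A φ N) : (approxOp A φ N U x : H) = A x := by
  have h1 : (complMinus A φ N).orthogonalProjectionOnto (x : H) = 0 := by
    rw [Submodule.orthogonalProjectionOnto_eq_zero_iff]
    intro w hw
    exact (Submodule.mem_orthogonal' _ _).1 (Submodule.mem_inf.1 hw).1 _ hx
  simp [approxOp, h1, Submodule.starProjection_eq_self_iff.2 hx]

lemma approxOp_apply_of_mem_compl (A : H →L[ℂ] H) (φ : H) (N : ℕ)
    (U : complMinus A φ N ≃ₗᵢ[ℂ] complPlus A φ N) (x : complMinus A φ N) :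
    (approxOp A φ N U ⟨x, (Submodule.mem_inf.1 x.2).2⟩ : H) = U x := by
  have h1 : (approxSpaceMinus A φ N).starProjection (x : H) = 0 := by
    rw [Submodule.starProjection_apply_eq_zero_iff]
    exact (Submodule.mem_inf.1 x.2).1
  simp [approxOp, h1]

/-- The operator with `u n ↦ q u n`, where `q ∈ ]-π, π]` is the argument of `l n`. -/
def argOp {E : Type*} [NormedAddCommGroup E] [InnerProductSpace ℂ E] {ι : Type*} [Fintype ι]
    (u : OrthonormalBasis ι ℂ E) (l : ι → ℂ) : E →ₗ[ℂ] E :=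
  u.toBasis.constr ℂ fun n => (Complex.arg (l n) : ℂ) • u n

lemma argOp_apply_of_eigenvalue {E : Type*} [NormedAddCommGroup E] [InnerProductSpace ℂ E]
    {ι : Type*} [Fintype ι] (u : OrthonormalBasis ι ℂ E) (l : ι → ℂ) (n : ι) (q : ℝ)
    (hq : q ∈ Set.Ioc (-Real.pi) Real.pi) (hl : l n = Complex.exp (q * Complex.I)) :
    argOp u l (u n) = (q : ℂ) • u n := by
  have h : Complex.arg (l n) = q := by
    rw [hl, Complex.exp_mul_I, Complex.arg_cos_add_sin_mul_I hq]
  have h2 := u.toBasis.constr_basis ℂ (fun n => (Complex.arg (l n) : ℂ) • u n) n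
  rw [OrthonormalBasis.coe_toBasis] at h2
  rw [argOp, h2, h]

lemma norm_argOp_le {E : Type*} [NormedAddCommGroup E] [InnerProductSpace ℂ E]
    {ι : Type*} [Fintype ι] (u : OrthonormalBasis ι ℂ E) (l : ι → ℂ) (x : E) :
    ‖argOp u l x‖ ≤ Real.pi * ‖x‖ := by
  have e : u.repr (argOp u l x) = WithLp.toLp 2 fun n => (Complex.arg (l n) : ℂ) * u.repr x n := by
    have : argOp u l x =
        u.repr.symm (WithLp.toLp 2 fun n => (Complex.arg (l n) : ℂ) * u.repr x n) := by
      rw [← u.sum_repr_symm, argOp, Module.Basis.constr_apply_fintype]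
      refine Finset.sum_congr rfl fun n _ => ?_
      rw [smul_smul, mul_comm]
      rfl
    rw [this, LinearIsometryEquiv.apply_symm_apply]
  rw [← u.repr.norm_map, ← u.repr.norm_map x, e, ← abs_of_pos Real.pi_pos,
    EuclideanSpace.norm_eq, EuclideanSpace.norm_eq, ← Real.sqrt_sq_eq_abs,
    ← Real.sqrt_mul (sq_nonneg _), Finset.mul_sum]
  refine Real.sqrt_le_sqrt (Finset.sum_le_sum fun n _ => ?_)
  rw [norm_mul, mul_pow]
  refine mul_le_mul_of_nonneg_right ?_ (sq_nonneg _)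
  rw [Complex.norm_real, Real.norm_eq_abs]
  exact pow_le_pow_left₀ (abs_nonneg _) (Complex.abs_arg_le_pi _) 2

end Approximation

/-! ### The embedding of `H` into the metric ultraproduct -/

section Embedding

variable {H : Type*} [NormedAddCommGroup H] [InnerProductSpace ℂ H] [CompleteSpace H]

/-- For all `m ≥ 1`, `D` contains the set of all `N ≥ 1` such that `√N` is an integer divisible
by `m`. -/
def IsSquareDivisible (D : Ultrafilter ℕ) : Prop :=
  ∀ m : ℕ, m ≠ 0 → {N : ℕ | N ≠ 0 ∧ ∃ k : ℕ, N = k ^ 2 ∧ m ∣ k} ∈ D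

lemma IsSquareDivisible.le_atTop {D : Ultrafilter ℕ} (hD : IsSquareDivisible D) :
    (D : Filter ℕ) ≤ atTop := by
  refine atTop_basis.ge_iff.2 fun m _ => ?_
  filter_upwards [hD (m + 1) (Nat.succ_ne_zero m)]
  rintro N ⟨h0, k, rfl, hk⟩
  have hk0 : 0 < k := Nat.pos_of_ne_zero (by rintro rfl; simp at h0)
  have := Nat.le_of_dvd hk0 hk
  simp only [Set.mem_Ici]
  nlinarith

lemma approxSpace_mono (A : H →L[ℂ] H) (φ : H) : Monotone (approxSpace A φ) := fun _ _ h =>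
  genSpan_mono A φ (Finset.product_subset_product (Finset.Iic_subset_Iic.2 h)
    (Finset.Iic_subset_Iic.2 h))

lemma exists_polyOp_mem (A : H →L[ℂ] H) (φ : H) (P : MvPolynomial (Fin 2) ℂ) :
    ∃ N, polyOp A P φ ∈ approxSpace A φ N := by
  refine ⟨P.totalDegree, ?_⟩
  rw [polyOp, sum_apply]
  refine Submodule.sum_mem _ fun m hm => ?_
  rw [smul_apply]
  refine Submodule.smul_mem _ _ (Submodule.subset_span ⟨(m 0, m 1), ?_, rfl⟩)
  have h := MvPolynomial.le_totalDegree hm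
  rw [Finsupp.sum_fintype _ _ (by simp), Fin.sum_univ_two] at h
  simp only [Finset.coe_product, Set.mem_prod, Finset.coe_Iic, Set.mem_Iic]
  omega

/-- There is exactly one isometric embedding of `H` into the metric ultraproduct of the spaces
`H_N` which maps `P(A, A*) φ` to the class of the sequence that is equal to `P(A, A*) φ` for
`D`-almost all `N`. -/
theorem existsUnique_embedding (A : H →L[ℂ] H) (φ : H) (hφ : IsCyclicVector A φ) (D : Ultrafilter ℕ)
    (hD : IsSquareDivisible D) :
    ∃! G : H →ₗᵢ[ℂ] MetricUltraproduct D (fun N => approxSpace A φ N),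
      ∀ (P : MvPolynomial (Fin 2) ℂ) (v : FiniteSeq D (fun N => approxSpace A φ N)),
        (∀ᶠ N in (D : Filter ℕ), (v.1 N : H) = polyOp A P φ) →
          G (polyOp A P φ) = MetricUltraproduct.mk D _ v := by
  have fin : ∀ x : H, (fun N => (approxSpace A φ N).orthogonalProjectionOnto x) ∈
      FiniteSeq D (fun N => approxSpace A φ N) := fun x =>
    ⟨‖x‖, Eventually.of_forall fun N => Submodule.norm_orthogonalProjectionOnto_apply_le _ x⟩
  let S : H →ₗ[ℂ] FiniteSeq D (fun N => approxSpace A φ N) :=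
    { toFun := fun x => ⟨_, fin x⟩
      map_add' := fun x y => Subtype.ext (funext fun N => map_add _ x y)
      map_smul' := fun c x => Subtype.ext (funext fun N => map_smul _ c x) }
  have dense : ⊤ ≤ (⨆ N, approxSpace A φ N).topologicalClosure := by
    intro x _
    refine closure_mono ?_ (hφ x)
    rintro _ ⟨P, rfl⟩
    obtain ⟨N, hN⟩ := exists_polyOp_mem A φ P
    exact (le_iSup (approxSpace A φ) N) hN
  have hS : ∀ P : MvPolynomial (Fin 2) ℂ, ∀ᶠ N in (D : Filter ℕ),
      ((S (polyOp A P φ)).1 N : H) = polyOp A P φ := by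
    intro P
    obtain ⟨M, hM⟩ := exists_polyOp_mem A φ P
    filter_upwards [hD.le_atTop (eventually_ge_atTop M)] with N h2
    exact Submodule.starProjection_eq_self_iff.2 (approxSpace_mono A φ h2 hM)
  refine ⟨⟨MetricUltraproduct.mk D _ ∘ₗ S, fun x => ?_⟩, ?_, ?_⟩
  · have h1 := MetricUltraproduct.tendsto_norm (S x)
    have h2 := ((Submodule.starProjection_tendsto_self (approxSpace A φ) (approxSpace_mono A φ) x
      dense).norm).mono_left hD.le_atTop
    exact tendsto_nhds_unique h1 h2
  · intro P v hv
    refine MetricUltraproduct.mk_eq_mk.2 ?_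
    intro ε hε
    filter_upwards [hv, hS P] with N h1 h2
    have h3 : (S (polyOp A P φ) - v).1 N = 0 :=
      sub_eq_zero.2 (Subtype.ext (h2.trans h1.symm))
    rw [h3, norm_zero]
    exact hε
  · intro G hG
    have hcont : Continuous fun x => MetricUltraproduct.mk D _ (S x) := by
      have hn : ∀ x, ‖(MetricUltraproduct.mk D _ ∘ₗ S) x‖ ≤ 1 * ‖x‖ := fun x => by
        rw [one_mul]
        exact le_of_tendsto' (MetricUltraproduct.tendsto_norm (S x)) fun N =>
          Submodule.norm_orthogonalProjectionOnto_apply_le _ x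
      exact ((MetricUltraproduct.mk D _ ∘ₗ S).mkContinuous 1 hn).continuous
    refine LinearIsometry.ext fun x => congrFun (Continuous.ext_on hφ G.continuous hcont ?_) x
    rintro _ ⟨P, rfl⟩
    exact hG P _ (hS P)

/-- The embedding `G^m` of `H` into the metric ultraproduct of the spaces `H_N`. -/
def embedding (A : H →L[ℂ] H) (φ : H) (hφ : IsCyclicVector A φ) (D : Ultrafilter ℕ)
    (hD : IsSquareDivisible D) :
    H →ₗᵢ[ℂ] MetricUltraproduct D (fun N => approxSpace A φ N) :=
  (existsUnique_embedding A φ hφ D hD).choose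

end Embedding

end

/-! The difficulty is that the argument jumps at `-1`, so `B_N` is not a continuous function of
`A_N`, and nothing is known about the spectrum of `A_N` away from the image of `H`. The remedy is to
recover logarithms from iterated square roots.

Each `A_N` is unitary, since `A` maps `H_N⁻` isometrically into `H_N⁺` and `U_N` respects the
complements. So its eigenvalues are `exp (i θ)` with `|θ| ≤ π`, and halving `θ` repeatedly gives
roots of `A_N` of order `2 ^ k`. Let `K k` be their ultraproduct and `L k = exp (i B / 2 ^ k)`. A
vector `P(A, A*) φ` lies in `H_N⁻` for large `N`, where `A_N` is `A`; by density the embedding `G`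
intertwines `K 0` with `L 0` (`map_approxOp_embedding`).

The intertwining descends to square roots (`intertwine_of_sq`): two square roots that are close
enough to the identity leave no room for the opposite sign. Here `K (k + 1)` is within `π / 2` of
the identity and `L (k + 1)` within `1 / 9`, and these sum to less than `2`. Hence `G` intertwines
`K k` with `L k` for every `k`.

Finally `2 ^ k (K k - 1)` tends pointwise to `i B^m`, because `|θ| ≤ π` makes the Taylor error
uniform in `N`, and `2 ^ k (L k - 1)` tends to `i B`. Comparing the limits gives `B^m G = G B`. -/

/-! ### Diagonal operators -/

section Diagonal

variable {E : Type*} [NormedAddCommGroup E] [InnerProductSpace ℂ E] {ι : Type*} [Fintype ι]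

/-- The operator which is diagonal with entries `f` in the orthonormal basis `u`. -/
noncomputable def diagOp (u : OrthonormalBasis ι ℂ E) (f : ι → ℂ) : E →ₗ[ℂ] E :=
  u.toBasis.constr ℂ fun n => f n • u n

lemma diagOp_apply_basis (u : OrthonormalBasis ι ℂ E) (f : ι → ℂ) (n : ι) :
    diagOp u f (u n) = f n • u n := by
  have h := u.toBasis.constr_basis ℂ (fun n => f n • u n) n
  rwa [OrthonormalBasis.coe_toBasis] at h

/-- An operator is determined by its values on a basis; this reduces the operator identities below
to identities between entries. -/
lemma eq_diagOp (u : OrthonormalBasis ι ℂ E) (f : ι → ℂ) (T : E →ₗ[ℂ] E)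
    (h : ∀ n, T (u n) = f n • u n) : T = diagOp u f :=
  u.toBasis.ext fun n => by simp [h, diagOp_apply_basis]

lemma argOp_eq_diagOp (u : OrthonormalBasis ι ℂ E) (l : ι → ℂ) :
    argOp u l = diagOp u fun n => (Complex.arg (l n) : ℂ) := rfl

lemma diagOp_comp (u : OrthonormalBasis ι ℂ E) (f g : ι → ℂ) :
    diagOp u f ∘ₗ diagOp u g = diagOp u fun n => f n * g n :=
  eq_diagOp u _ _ fun n => by simp [diagOp_apply_basis, smul_smul, mul_comm]

lemma diagOp_sub (u : OrthonormalBasis ι ℂ E) (f g : ι → ℂ) :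
    diagOp u f - diagOp u g = diagOp u fun n => f n - g n :=
  eq_diagOp u _ _ fun n => by simp [diagOp_apply_basis, sub_smul]

lemma smul_diagOp (u : OrthonormalBasis ι ℂ E) (c : ℂ) (f : ι → ℂ) :
    c • diagOp u f = diagOp u fun n => c * f n :=
  eq_diagOp u _ _ fun n => by simp [diagOp_apply_basis, smul_smul]

lemma id_eq_diagOp (u : OrthonormalBasis ι ℂ E) : LinearMap.id = diagOp u fun _ => 1 :=
  eq_diagOp u _ _ fun n => by simp

lemma repr_diagOp (u : OrthonormalBasis ι ℂ E) (f : ι → ℂ) (x : E) (n : ι) :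
    u.repr (diagOp u f x) n = f n * u.repr x n := by
  have : diagOp u f x = u.repr.symm (WithLp.toLp 2 fun n => f n * u.repr x n) := by
    rw [← u.sum_repr_symm, diagOp, Module.Basis.constr_apply_fintype]
    refine Finset.sum_congr rfl fun n _ => ?_
    rw [smul_smul, mul_comm]
    rfl
  rw [this, LinearIsometryEquiv.apply_symm_apply]

/-- Parseval, coordinate by coordinate. The bound does not see the dimension, so it can be uniform
in `N`. -/
lemma norm_diagOp_le (u : OrthonormalBasis ι ℂ E) {f : ι → ℂ} {C : ℝ} (hC : 0 ≤ C)
    (hf : ∀ n, ‖f n‖ ≤ C) (x : E) : ‖diagOp u f x‖ ≤ C * ‖x‖ := by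
  rw [← u.repr.norm_map, ← u.repr.norm_map x, EuclideanSpace.norm_eq, EuclideanSpace.norm_eq]
  conv_rhs => rw [← Real.sqrt_sq hC]
  rw [← Real.sqrt_mul (sq_nonneg _), Finset.mul_sum]
  refine Real.sqrt_le_sqrt (Finset.sum_le_sum fun n _ => ?_)
  rw [repr_diagOp, norm_mul, mul_pow]
  exact mul_le_mul_of_nonneg_right (pow_le_pow_left₀ (norm_nonneg _) (hf n) 2) (sq_nonneg _)

end Diagonal

/-! ### Ultraproducts of operators -/

namespace MetricUltraproduct

variable {D : Ultrafilter ℕ} {E : ℕ → Type*} [∀ N, NormedAddCommGroup (E N)]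
  [∀ N, InnerProductSpace ℂ (E N)]

lemma exists_map_mk (T : ∀ N, E N →ₗ[ℂ] E N) (hT : ∃ C : ℝ, ∀ N x, ‖T N x‖ ≤ C * ‖x‖)
    (v : FiniteSeq D E) :
    ∃ w : FiniteSeq D E, (∀ N, w.1 N = T N (v.1 N)) ∧ map T hT (mk D E v) = mk D E w := by
  obtain ⟨K, hK⟩ := v.2
  obtain ⟨C, hC⟩ := id hT
  have hw : (fun N => T N (v.1 N)) ∈ FiniteSeq D E := by
    refine ⟨|C| * K, ?_⟩
    filter_upwards [hK] with N hN
    calc ‖T N (v.1 N)‖ ≤ C * ‖v.1 N‖ := hC N _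
      _ ≤ |C| * ‖v.1 N‖ := mul_le_mul_of_nonneg_right (le_abs_self C) (norm_nonneg _)
      _ ≤ |C| * K := mul_le_mul_of_nonneg_left hN (abs_nonneg C)
  exact ⟨⟨_, hw⟩, fun _ => rfl, map_mk T hT v _ fun _ => rfl⟩

lemma norm_map_apply_le (T : ∀ N, E N →ₗ[ℂ] E N) (hT : ∃ C : ℝ, ∀ N x, ‖T N x‖ ≤ C * ‖x‖) {C : ℝ}
    (hC : ∀ N x, ‖T N x‖ ≤ C * ‖x‖) (x : MetricUltraproduct D E) : ‖map T hT x‖ ≤ C * ‖x‖ := by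
  obtain ⟨v, rfl⟩ := mk_surjective x
  obtain ⟨w, hw, e⟩ := exists_map_mk T hT v
  rw [e]
  exact le_of_tendsto_of_tendsto' (tendsto_norm w) ((tendsto_norm v).const_mul C)
    fun N => (hw N).symm ▸ hC N _

lemma map_sub_apply (T S R : ∀ N, E N →ₗ[ℂ] E N) (hT : ∃ C : ℝ, ∀ N x, ‖T N x‖ ≤ C * ‖x‖)
    (hS : ∃ C : ℝ, ∀ N x, ‖S N x‖ ≤ C * ‖x‖) (hR : ∃ C : ℝ, ∀ N x, ‖R N x‖ ≤ C * ‖x‖)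
    (h : ∀ N, T N - S N = R N) (x : MetricUltraproduct D E) :
    map T hT x - map S hS x = map R hR x := by
  obtain ⟨v, rfl⟩ := mk_surjective x
  obtain ⟨w, hw, e⟩ := exists_map_mk T hT v
  obtain ⟨w', hw', e'⟩ := exists_map_mk S hS v
  rw [e, e', ← _root_.map_sub, eq_comm]
  refine map_mk R hR v _ fun N => ?_
  rw [← h N, LinearMap.sub_apply, ← hw, ← hw']
  rfl

lemma map_comp_apply (T S R : ∀ N, E N →ₗ[ℂ] E N) (hT : ∃ C : ℝ, ∀ N x, ‖T N x‖ ≤ C * ‖x‖)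
    (hS : ∃ C : ℝ, ∀ N x, ‖S N x‖ ≤ C * ‖x‖) (hR : ∃ C : ℝ, ∀ N x, ‖R N x‖ ≤ C * ‖x‖)
    (h : ∀ N, T N ∘ₗ S N = R N) (x : MetricUltraproduct D E) :
    map T hT (map S hS x) = map R hR x := by
  obtain ⟨v, rfl⟩ := mk_surjective x
  obtain ⟨w, hw, e⟩ := exists_map_mk S hS v
  obtain ⟨w', hw', e'⟩ := exists_map_mk T hT w
  rw [e, e', eq_comm]
  refine map_mk R hR v _ fun N => ?_
  rw [← h N, LinearMap.comp_apply, ← hw, ← hw']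

lemma smul_map_apply (c : ℂ) (T R : ∀ N, E N →ₗ[ℂ] E N) (hT : ∃ C : ℝ, ∀ N x, ‖T N x‖ ≤ C * ‖x‖)
    (hR : ∃ C : ℝ, ∀ N x, ‖R N x‖ ≤ C * ‖x‖)
    (h : ∀ N, c • T N = R N) (x : MetricUltraproduct D E) :
    c • map T hT x = map R hR x := by
  obtain ⟨v, rfl⟩ := mk_surjective x
  obtain ⟨w, hw, e⟩ := exists_map_mk T hT v
  rw [e, ← _root_.map_smul, eq_comm]
  refine map_mk R hR v _ fun N => ?_
  rw [← h N, LinearMap.smul_apply, ← hw]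
  rfl

lemma map_id_apply (hT : ∃ C : ℝ, ∀ N (x : E N), ‖(LinearMap.id : E N →ₗ[ℂ] E N) x‖ ≤ C * ‖x‖)
    (x : MetricUltraproduct D E) :
    map (fun _ => LinearMap.id) hT x = x := by
  obtain ⟨v, rfl⟩ := mk_surjective x
  exact map_mk _ hT v v fun N => rfl

end MetricUltraproduct

/-! ### Intertwining of square roots -/

/-- If `K²` and `L²` are intertwined by `G` and `K`, `L` are close to the identity, then `K` and `L`
are intertwined by `G`. -/
lemma intertwine_of_sq {E F : Type*} [NormedAddCommGroup E] [NormedSpace ℂ E]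
    [NormedAddCommGroup F] [NormedSpace ℂ F] (K : F →L[ℂ] F) (L : E →L[ℂ] E) (G : E →L[ℂ] F)
    {a b : ℝ} (ha : 0 ≤ a) (hK : ∀ y, ‖K y - y‖ ≤ a * ‖y‖) (hL : ‖L - 1‖ ≤ b) (hab : a + b < 2)
    (h : ∀ x, K (K (G x)) = G (L (L x))) (x : E) : K (G x) = G (L x) := by
  set Y : E →L[ℂ] F := K ∘L G - G ∘L L with hY
  -- The defect `Y` anticommutes: `K Y = K² G - K G L = G L² - K G L = -Y L`.
  have hKY : ∀ x, K (Y x) = -Y (L x) := by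
    intro x
    simp [hY, h]
  have hle : ‖(2 : ℂ) • Y‖ ≤ (a + b) * ‖Y‖ := by
    have hb : 0 ≤ b := (norm_nonneg _).trans hL
    refine ContinuousLinearMap.opNorm_le_bound _ (by positivity) fun x => ?_
    -- Since `K Y + Y L = 0`, replacing `K` and `L` by the identity costs only `(K - 1) Y + Y (L -
    -- 1)`.
    have e : ((2 : ℂ) • Y) x = -(K (Y x) - Y x) - Y ((L - 1) x) := by
      have e1 : (L - 1) x = L x - x := rfl
      have e2 : ((2 : ℂ) • Y) x = Y x + Y x := two_smul ℂ (Y x)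
      rw [hKY, e1, e2, map_sub]
      abel
    have h1 : ‖Y ((L - 1) x)‖ ≤ ‖Y‖ * (b * ‖x‖) :=
      Y.le_opNorm_of_le ((L - 1).le_of_opNorm_le hL x)
    have h2 : ‖K (Y x) - Y x‖ ≤ a * (‖Y‖ * ‖x‖) :=
      (hK _).trans (mul_le_mul_of_nonneg_left (Y.le_opNorm x) ha)
    rw [e]
    refine (norm_sub_le _ _).trans ?_
    rw [norm_neg]
    linarith
  rw [norm_smul, Complex.norm_ofNat] at hle
  -- `2 ‖Y‖ ≤ (a + b) ‖Y‖` with `a + b < 2`.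
  have h0 : ‖Y‖ = 0 := by nlinarith [norm_nonneg Y]
  have h1 : Y x = 0 := by rw [norm_eq_zero.1 h0]; rfl
  exact sub_eq_zero.1 h1

/-! ### The exponential of a small self-adjoint operator -/

section Exponential

variable {H : Type*} [NormedAddCommGroup H] [InnerProductSpace ℂ H] [CompleteSpace H]

/-- Up to norm `π` the distance from `exp (i S)` to `1` is the chord of the angle `‖S‖`, with square
`2 (1 - cos ‖S‖)`, and a chord is no longer than its arc. -/
lemma norm_exp_I_smul_sub_one_le {S : H →L[ℂ] H} (hS : IsSelfAdjoint S) (h : ‖S‖ ≤ Real.pi) :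
    ‖NormedSpace.exp (Complex.I • S) - 1‖ ≤ ‖S‖ := by
  have e := selfAdjoint.norm_sq_expUnitary_sub_one (x := (⟨S, hS⟩ : selfAdjoint (H →L[ℂ] H))) h
  rw [selfAdjoint.expUnitary_coe] at e
  have h1 := Real.one_sub_sq_div_two_le_cos (x := ‖S‖)
  refine le_of_sq_le_sq ?_ (norm_nonneg _)
  change ‖NormedSpace.exp (Complex.I • S) - 1‖ ^ 2 = 2 * (1 - Real.cos ‖S‖) at e
  linarith

lemma adjoint_mul_exp_I_smul {S : H →L[ℂ] H} (hS : IsSelfAdjoint S) :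
    ContinuousLinearMap.adjoint (NormedSpace.exp (Complex.I • S)) *
      NormedSpace.exp (Complex.I • S) = 1 :=
  Unitary.star_mul_self_of_mem
    (selfAdjoint.expUnitary (⟨S, hS⟩ : selfAdjoint (H →L[ℂ] H))).2

lemma norm_exp_I_smul_apply {S : H →L[ℂ] H} (hS : IsSelfAdjoint S) (x : H) :
    ‖NormedSpace.exp (Complex.I • S) x‖ = ‖x‖ :=
  (ContinuousLinearMap.norm_map_iff_adjoint_comp_self _).2 (adjoint_mul_exp_I_smul hS) x

lemma exp_half_pow_succ_mul_self (S : H →L[ℂ] H) (k : ℕ) :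
    NormedSpace.exp ((1 / 2 : ℂ) ^ (k + 1) • S) * NormedSpace.exp ((1 / 2 : ℂ) ^ (k + 1) • S) =
      NormedSpace.exp ((1 / 2 : ℂ) ^ k • S) := by
  let +nondep : NormedAlgebra ℚ (H →L[ℂ] H) := .restrictScalars ℚ ℂ _
  rw [← NormedSpace.exp_add_of_commute (Commute.refl _), ← add_smul]
  congr 2
  ring

/-- These are the difference quotients at `0` of `t ↦ exp (t S)`, taken along `t = 2 ^ (-k)`. -/
lemma tendsto_two_pow_smul_exp_sub_one (S : H →L[ℂ] H) :
    Tendsto (fun k : ℕ => (2 : ℂ) ^ k • (NormedSpace.exp ((1 / 2 : ℂ) ^ k • S) - 1)) atTop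
      (𝓝 S) := by
  have h := (hasDerivAt_exp_smul_const (𝕂 := ℂ) S 0).tendsto_slope_zero
  have ht : Tendsto (fun k : ℕ => (1 / 2 : ℂ) ^ k) atTop (𝓝[≠] 0) := by
    refine tendsto_nhdsWithin_iff.2 ⟨?_, Eventually.of_forall fun k => by simp⟩
    exact tendsto_pow_atTop_nhds_zero_of_norm_lt_one (by norm_num)
  have h2 := h.comp ht
  simp only [zero_smul, NormedSpace.exp_zero, one_mul] at h2
  refine h2.congr fun k => ?_
  simp

end Exponential

/-! ### The approximating operators -/

section ApproxOp

variable {H : Type*} [NormedAddCommGroup H] [InnerProductSpace ℂ H] [CompleteSpace H]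

lemma apply_mem_approxSpacePlus (A : H →L[ℂ] H) (φ : H) (N : ℕ) {x : H}
    (hx : x ∈ approxSpaceMinus A φ N) : A x ∈ approxSpacePlus A φ N := by
  have : approxSpaceMinus A φ N ≤ (approxSpacePlus A φ N).comap (A : H →ₗ[ℂ] H) := by
    refine Submodule.span_le.2 ?_
    rintro _ ⟨⟨i, j⟩, hij, rfl⟩
    refine Submodule.subset_span ⟨(i + 1, j), ?_, ?_⟩
    · simp only [Finset.coe_product, Set.mem_prod, Finset.coe_Iio, Finset.coe_Iic, Set.mem_Iio,
        Set.mem_Iic, Finset.coe_Ioc, Set.mem_Ioc] at hij ⊢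
      omega
    · simp [pow_succ']
  exact this hx

lemma approxSpaceMinus_le (A : H →L[ℂ] H) (φ : H) (N : ℕ) :
    approxSpaceMinus A φ N ≤ approxSpace A φ N :=
  genSpan_mono A φ (Finset.product_subset_product (fun i hi => by
    simp only [Finset.mem_Iio, Finset.mem_Iic] at *; omega) subset_rfl)

/-- Places a fixed vector `P(A, A*) φ` in the domain where `A_N` is `A`, for all large `N`. -/
lemma approxSpace_le_minus (A : H →L[ℂ] H) (φ : H) {M N : ℕ} (h : M < N) :
    approxSpace A φ M ≤ approxSpaceMinus A φ N :=
  genSpan_mono A φ (Finset.product_subset_product (fun i hi => by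
    simp only [Finset.mem_Iio, Finset.mem_Iic] at *; omega) (Finset.Iic_subset_Iic.2 h.le))

/-- Pythagoras twice: `x` splits orthogonally along `H_N⁻` and `W⁻`, and the images of the two parts
are orthogonal because they lie in `H_N⁺` and `W⁺`. -/
lemma norm_approxOp (A : H →L[ℂ] H) (hA : ∀ x, ‖A x‖ = ‖x‖) (φ : H) (N : ℕ)
    (U : complMinus A φ N ≃ₗᵢ[ℂ] complPlus A φ N) (x : approxSpace A φ N) :
    ‖approxOp A φ N U x‖ = ‖x‖ := by
  set p : H := (approxSpaceMinus A φ N).starProjection x with hp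
  have hpm : p ∈ approxSpaceMinus A φ N := Submodule.starProjection_apply_mem _ _
  have hpo : (x : H) - p ∈ (approxSpaceMinus A φ N)ᗮ :=
    Submodule.sub_starProjection_mem_orthogonal _
  have hpN : p ∈ approxSpace A φ N := approxSpaceMinus_le A φ N hpm
  let w : complMinus A φ N :=
    ⟨x - p, Submodule.mem_inf.2 ⟨hpo, Submodule.sub_mem _ x.2 hpN⟩⟩
  have hx : x = ⟨p, hpN⟩ + ⟨w, (Submodule.mem_inf.1 w.2).2⟩ := Subtype.ext (by simp [w])
  have e : (approxOp A φ N U x : H) = A p + U w := by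
    conv_lhs => rw [hx]
    rw [map_add, Submodule.coe_add, approxOp_apply_of_mem_minus A φ N U _ hpm,
      approxOp_apply_of_mem_compl]
  have o1 : ⟪A p, (U w : H)⟫_ℂ = 0 :=
    (Submodule.mem_orthogonal _ _).1 (Submodule.mem_inf.1 (U w).2).1 _
      (apply_mem_approxSpacePlus A φ N hpm)
  have o2 : ⟪p, (w : H)⟫_ℂ = 0 := (Submodule.mem_orthogonal _ _).1 hpo _ hpm
  have n1 := norm_add_sq_eq_norm_sq_add_norm_sq_of_inner_eq_zero _ _ o1
  have n2 := norm_add_sq_eq_norm_sq_add_norm_sq_of_inner_eq_zero _ _ o2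
  have e2 : (x : H) = p + w := by simp [w]
  have n3 : ‖(U w : H)‖ = ‖(w : H)‖ := U.norm_map w
  rw [← e, hA, n3, ← n2, ← e2] at n1
  exact (mul_self_inj (norm_nonneg _) (norm_nonneg _)).1 n1

lemma norm_eigenvalue_approxOp (A : H →L[ℂ] H) (hA : ∀ x, ‖A x‖ = ‖x‖) (φ : H) (N : ℕ)
    (U : complMinus A φ N ≃ₗᵢ[ℂ] complPlus A φ N) {v : approxSpace A φ N} (hv : v ≠ 0) {c : ℂ}
    (h : approxOp A φ N U v = c • v) : ‖c‖ = 1 := by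
  have e := norm_approxOp A hA φ N U v
  rw [h, norm_smul] at e
  exact (mul_eq_right₀ (norm_ne_zero_iff.2 hv)).1 e

end ApproxOp

/-! ### The embedding through orthogonal projections -/

section Embedding

variable {H : Type*} [NormedAddCommGroup H] [InnerProductSpace ℂ H] [CompleteSpace H]

/-- The sequence of the orthogonal projections of `x` to the spaces `H_N`. -/
noncomputable def projSeq (A : H →L[ℂ] H) (φ : H) (D : Ultrafilter ℕ) (x : H) :
    FiniteSeq D (fun N => approxSpace A φ N) :=
  ⟨fun N => (approxSpace A φ N).orthogonalProjectionOnto x,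
    ‖x‖, Eventually.of_forall fun _ => Submodule.norm_orthogonalProjectionOnto_apply_le _ x⟩

lemma embedding_polyOp (A : H →L[ℂ] H) (φ : H) (hφ : IsCyclicVector A φ) (D : Ultrafilter ℕ)
    (hD : IsSquareDivisible D) (P : MvPolynomial (Fin 2) ℂ)
    (v : FiniteSeq D (fun N => approxSpace A φ N))
    (hv : ∀ᶠ N in (D : Filter ℕ), (v.1 N : H) = polyOp A P φ) :
    embedding A φ hφ D hD (polyOp A P φ) = MetricUltraproduct.mk D _ v :=
  (existsUnique_embedding A φ hφ D hD).choose_spec.1 P v hv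

/-- Both sides are continuous and agree on the dense set of vectors `P(A, A*) φ`, which the
projections eventually fix. This gives an explicit representative for every `x`. -/
lemma embedding_apply (A : H →L[ℂ] H) (φ : H) (hφ : IsCyclicVector A φ) (D : Ultrafilter ℕ)
    (hD : IsSquareDivisible D) (x : H) :
    embedding A φ hφ D hD x = MetricUltraproduct.mk D _ (projSeq A φ D x) := by
  let S : H →ₗ[ℂ] MetricUltraproduct D (fun N => approxSpace A φ N) :=
    MetricUltraproduct.mk D _ ∘ₗ
    { toFun := projSeq A φ D
      map_add' := fun x y => Subtype.ext (funext fun N => map_add _ x y)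
      map_smul' := fun c x => Subtype.ext (funext fun N => map_smul _ c x) }
  have hn : ∀ x, ‖S x‖ ≤ 1 * ‖x‖ := fun x => by
    rw [one_mul]
    exact le_of_tendsto' (MetricUltraproduct.tendsto_norm (projSeq A φ D x)) fun N =>
      Submodule.norm_orthogonalProjectionOnto_apply_le _ x
  refine congrFun (Continuous.ext_on hφ (embedding A φ hφ D hD).continuous
    (S.mkContinuous 1 hn).continuous ?_) x
  rintro _ ⟨P, rfl⟩
  refine embedding_polyOp A φ hφ D hD P _ ?_
  obtain ⟨M, hM⟩ := exists_polyOp_mem A φ P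
  filter_upwards [hD.le_atTop (eventually_ge_atTop M)] with N h2
  exact Submodule.starProjection_eq_self_iff.2 (approxSpace_mono A φ h2 hM)

/-- The ultraproduct of the approximations of `A` extends the image of `A`. -/
lemma map_approxOp_embedding (A : H →L[ℂ] H) (φ : H) (hφ : IsCyclicVector A φ) (D : Ultrafilter ℕ)
    (hD : IsSquareDivisible D) (U : ∀ N, complMinus A φ N ≃ₗᵢ[ℂ] complPlus A φ N)
    (hT : ∃ C : ℝ, ∀ N x, ‖approxOp A φ N (U N) x‖ ≤ C * ‖x‖) (x : H) :
    MetricUltraproduct.map (D := D) (fun N => approxOp A φ N (U N)) hT (embedding A φ hφ D hD x) =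
      embedding A φ hφ D hD (A x) := by
  refine congrFun (Continuous.ext_on hφ
    ((ContinuousLinearMap.continuous _).comp (embedding A φ hφ D hD).continuous)
    ((embedding A φ hφ D hD).continuous.comp A.continuous) ?_) x
  rintro _ ⟨P, rfl⟩
  simp only [Function.comp_apply]
  rw [embedding_apply, embedding_apply]
  obtain ⟨w, hw, e⟩ := MetricUltraproduct.exists_map_mk (D := D)
    (fun N => approxOp A φ N (U N)) hT (projSeq A φ D (polyOp A P φ))
  rw [e, MetricUltraproduct.mk_eq_mk]
  intro ε hε
  obtain ⟨M, hM⟩ := exists_polyOp_mem A φ P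
  -- The inequality is strict because the vector must lie in `H_N⁻`, not only in `H_N`, for `A_N` to
  -- act on it as `A`.
  filter_upwards [hD.le_atTop (eventually_gt_atTop M)] with N hN
  have hm : polyOp A P φ ∈ approxSpaceMinus A φ N := approxSpace_le_minus A φ hN hM
  have h1 : ((projSeq A φ D (polyOp A P φ)).1 N : H) = polyOp A P φ :=
    Submodule.starProjection_eq_self_iff.2 (approxSpaceMinus_le A φ N hm)
  have h2 : ((projSeq A φ D (A (polyOp A P φ))).1 N : H) = A (polyOp A P φ) :=
    Submodule.starProjection_eq_self_iff.2 (apply_mem_approxSpace A φ N hm)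
  have h3 : (w.1 N : H) = A (polyOp A P φ) := by
    rw [hw, approxOp_apply_of_mem_minus A φ N (U N) _ (h1.symm ▸ hm), h1]
  have h4 : (w - projSeq A φ D (A (polyOp A P φ))).1 N = 0 :=
    sub_eq_zero.2 (Subtype.ext (h3.trans h2.symm))
  rw [h4, norm_zero]
  exact hε

end Embedding

/-! ### Roots of the ultraproduct of unitary operators -/

section Roots

variable {D : Ultrafilter ℕ} {E : ℕ → Type*} [∀ N, NormedAddCommGroup (E N)]
  [∀ N, InnerProductSpace ℂ (E N)] {ι : ℕ → Type*} [∀ N, Fintype (ι N)]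

/-- The root of order `2 ^ k` of the diagonal operator with entries `l`. -/
noncomputable def rootOp {E ι : Type*} [NormedAddCommGroup E] [InnerProductSpace ℂ E] [Fintype ι]
    (u : OrthonormalBasis ι ℂ E) (l : ι → ℂ) (k : ℕ) : E →ₗ[ℂ] E :=
  diagOp u fun n => Complex.exp (Complex.I * (Complex.arg (l n) / 2 ^ k : ℝ))

lemma rootOp_bounded (u : ∀ N, OrthonormalBasis (ι N) ℂ (E N)) (l : ∀ N, ι N → ℂ) (k : ℕ) :
    ∃ C : ℝ, ∀ N x, ‖rootOp (u N) (l N) k x‖ ≤ C * ‖x‖ :=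
  ⟨1, fun _ x => norm_diagOp_le _ zero_le_one
    (fun _ => (Complex.norm_exp_I_mul_ofReal _).le) x⟩

/-- The ultraproduct of the roots of order `2 ^ k`. -/
noncomputable def rootMap (D : Ultrafilter ℕ) (u : ∀ N, OrthonormalBasis (ι N) ℂ (E N))
    (l : ∀ N, ι N → ℂ) (k : ℕ) : MetricUltraproduct D E →L[ℂ] MetricUltraproduct D E :=
  MetricUltraproduct.map (fun N => rootOp (u N) (l N) k) (rootOp_bounded u l k)

lemma rootMap_succ_rootMap_succ (u : ∀ N, OrthonormalBasis (ι N) ℂ (E N)) (l : ∀ N, ι N → ℂ)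
    (k : ℕ) (x : MetricUltraproduct D E) :
    rootMap D u l (k + 1) (rootMap D u l (k + 1) x) = rootMap D u l k x := by
  refine MetricUltraproduct.map_comp_apply _ _ _ _ _ _ (fun N => ?_) x
  rw [rootOp, rootOp, diagOp_comp]
  congr 1
  funext n
  rw [← Complex.exp_add]
  congr 1
  push_cast
  ring

/-- Entrywise `|exp (i t) - 1| ≤ |t|` with `t = θ / 2 ^ k` and `|θ| ≤ π`; the bound is the same for
all `N` and so survives the ultraproduct. -/
lemma norm_rootMap_sub_le (u : ∀ N, OrthonormalBasis (ι N) ℂ (E N)) (l : ∀ N, ι N → ℂ)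
    (k : ℕ) (x : MetricUltraproduct D E) :
    ‖rootMap D u l k x - x‖ ≤ Real.pi / 2 ^ k * ‖x‖ := by
  have hb : ∀ N (y : E N), ‖(rootOp (u N) (l N) k - LinearMap.id : E N →ₗ[ℂ] E N) y‖ ≤
      Real.pi / 2 ^ k * ‖y‖ := by
    intro N y
    rw [id_eq_diagOp (u N), rootOp, diagOp_sub]
    refine norm_diagOp_le _ (by positivity) (fun n => ?_) y
    refine Real.norm_exp_I_mul_ofReal_sub_one_le.trans ?_
    rw [norm_div, Real.norm_eq_abs, norm_pow, Real.norm_ofNat]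
    exact div_le_div_of_nonneg_right (Complex.abs_arg_le_pi _) (by positivity)
  have h1 : ∃ C : ℝ, ∀ N (y : E N), ‖(LinearMap.id : E N →ₗ[ℂ] E N) y‖ ≤ C * ‖y‖ :=
    ⟨1, fun N y => by simp⟩
  have e := MetricUltraproduct.map_id_apply h1 x
  nth_rewrite 2 [← e]
  rw [rootMap, MetricUltraproduct.map_sub_apply _ _ _ _ _ ⟨_, hb⟩ fun N => rfl]
  exact MetricUltraproduct.norm_map_apply_le _ _ hb x

lemma tendsto_two_pow_smul_rootMap_sub (u : ∀ N, OrthonormalBasis (ι N) ℂ (E N))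
    (l : ∀ N, ι N → ℂ) (hT : ∃ C : ℝ, ∀ N x, ‖argOp (u N) (l N) x‖ ≤ C * ‖x‖)
    (x : MetricUltraproduct D E) :
    Tendsto (fun k : ℕ => (2 : ℂ) ^ k • (rootMap D u l k x - x)) atTop
      (𝓝 (Complex.I • MetricUltraproduct.map (fun N => argOp (u N) (l N)) hT x)) := by
  -- Second-order Taylor bound for an entry: `2 ^ k (|θ| / 2 ^ k) ^ 2 ≤ π ^ 2 / 2 ^ k`. From `k = 2`
  -- on, `|θ| / 2 ^ k ≤ π / 4 ≤ 1`, as the estimate for `exp` requires.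
  have hb : ∀ k : ℕ, 2 ≤ k → ∀ N (y : E N),
      ‖((2 : ℂ) ^ k • (rootOp (u N) (l N) k - LinearMap.id) - Complex.I • argOp (u N) (l N) :
        E N →ₗ[ℂ] E N) y‖ ≤ Real.pi ^ 2 * (1 / 2) ^ k * ‖y‖ := by
    intro k hk N y
    rw [id_eq_diagOp (u N), rootOp, diagOp_sub, smul_diagOp, argOp_eq_diagOp, smul_diagOp,
      diagOp_sub]
    refine norm_diagOp_le _ (by positivity) (fun n => ?_) y
    set θ := Complex.arg (l N n)
    have hθ : |θ| ≤ Real.pi := Complex.abs_arg_le_pi _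
    set z : ℂ := Complex.I * (θ / 2 ^ k : ℝ) with hz
    have hzn : ‖z‖ = |θ| / 2 ^ k := by
      rw [hz, norm_mul, Complex.norm_I, one_mul, Complex.norm_real, norm_div, norm_pow,
        Real.norm_ofNat, Real.norm_eq_abs]
    have h2k : (4 : ℝ) ≤ 2 ^ k := by
      calc (4 : ℝ) = 2 ^ 2 := by norm_num
        _ ≤ 2 ^ k := pow_le_pow_right₀ (by norm_num) hk
    have hz1 : ‖z‖ ≤ 1 := by
      rw [hzn, div_le_one (by positivity)]
      linarith [Real.pi_le_four]
    have e : (2 : ℂ) ^ k * (Complex.exp z - 1) - Complex.I * θ =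
        2 ^ k * (Complex.exp z - 1 - z) := by
      rw [hz]
      push_cast
      field_simp
    rw [e, norm_mul, norm_pow, Complex.norm_ofNat]
    calc (2 : ℝ) ^ k * ‖Complex.exp z - 1 - z‖ ≤ 2 ^ k * (|θ| / 2 ^ k) ^ 2 := by
          rw [← hzn]
          exact mul_le_mul_of_nonneg_left (Complex.norm_exp_sub_one_sub_id_le hz1) (by positivity)
      _ = |θ| ^ 2 * (1 / 2) ^ k := by
          rw [one_div, inv_pow]
          field_simp
      _ ≤ Real.pi ^ 2 * (1 / 2) ^ k := by gcongr
  have h1 : ∃ C : ℝ, ∀ N (y : E N), ‖(LinearMap.id : E N →ₗ[ℂ] E N) y‖ ≤ C * ‖y‖ :=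
    ⟨1, fun N y => by simp⟩
  -- Crude bounds, needed only for the ultraproducts of the intermediate operators to be defined.
  have hK : ∀ k : ℕ, ∃ C : ℝ, ∀ N (y : E N),
      ‖(rootOp (u N) (l N) k - LinearMap.id : E N →ₗ[ℂ] E N) y‖ ≤ C * ‖y‖ := by
    intro k
    refine ⟨2, fun N y => ?_⟩
    rw [id_eq_diagOp (u N), rootOp, diagOp_sub]
    refine norm_diagOp_le _ (by norm_num) (fun n => (norm_sub_le _ _).trans ?_) y
    rw [Complex.norm_exp_I_mul_ofReal]
    norm_num
  have hsm : ∀ (c : ℂ) (T : ∀ N, E N →ₗ[ℂ] E N), (∃ C : ℝ, ∀ N x, ‖T N x‖ ≤ C * ‖x‖) →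
      ∃ C : ℝ, ∀ N x, ‖(c • T N) x‖ ≤ C * ‖x‖ := by
    rintro c T ⟨C, hC⟩
    refine ⟨‖c‖ * C, fun N x => ?_⟩
    rw [LinearMap.smul_apply, norm_smul, mul_assoc]
    exact mul_le_mul_of_nonneg_left (hC N x) (norm_nonneg c)
  rw [tendsto_iff_norm_sub_tendsto_zero]
  have h0 : Tendsto (fun k : ℕ => Real.pi ^ 2 * (1 / 2) ^ k * ‖x‖) atTop (𝓝 0) := by
    have := (tendsto_pow_atTop_nhds_zero_of_lt_one (r := (1 / 2 : ℝ)) (by norm_num)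
      (by norm_num)).const_mul (Real.pi ^ 2)
    simpa using this.mul_const ‖x‖
  refine squeeze_zero' (Eventually.of_forall fun k => norm_nonneg _) ?_ h0
  filter_upwards [eventually_ge_atTop 2] with k hk
  -- With `x` written as the ultraproduct of identities applied to `x`, the whole expression becomes
  -- the ultraproduct of the operators bounded in `hb`.
  nth_rewrite 2 [← MetricUltraproduct.map_id_apply h1 x]
  rw [rootMap, MetricUltraproduct.map_sub_apply _ _ _ _ _ (hK k) fun N => rfl,
    MetricUltraproduct.smul_map_apply _ _ _ _ (hsm _ _ (hK k)) fun N => rfl,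
    MetricUltraproduct.smul_map_apply _ _ _ _ (hsm _ _ hT) fun N => rfl,
    MetricUltraproduct.map_sub_apply _ _ _ _ _ ⟨_, hb k hk⟩ fun N => rfl]
  exact MetricUltraproduct.norm_map_apply_le _ _ (hb k hk) x

end Roots

/-! ### From roots to generators, and the theorem -/

/-- If `exp (i B)` is the restriction of an operator with a coherent sequence `K` of roots of order
`2 ^ k` which are close to the identity, then `B` is the restriction of the generator `C`. -/
theorem intertwine_of_roots {H F : Type*} [NormedAddCommGroup H] [InnerProductSpace ℂ H]
    [CompleteSpace H] [NormedAddCommGroup F] [NormedSpace ℂ F] (B : H →L[ℂ] H)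
    (hB : IsSelfAdjoint B) (hBnorm : ‖B‖ ≤ 1 / 9) (G : H →L[ℂ] F) (K : ℕ → F →L[ℂ] F)
    (C : F →L[ℂ] F) (h0 : ∀ x, K 0 (G x) = G (NormedSpace.exp (Complex.I • B) x))
    (hK : ∀ k y, K (k + 1) (K (k + 1) y) = K k y)
    (hb : ∀ k y, ‖K k y - y‖ ≤ Real.pi / 2 ^ k * ‖y‖)
    (hC : ∀ y, Tendsto (fun k : ℕ => (2 : ℂ) ^ k • (K k y - y)) atTop (𝓝 (Complex.I • C y)))
    (x : H) : C (G x) = G (B x) := by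
  let L : ℕ → H →L[ℂ] H := fun k => NormedSpace.exp ((1 / 2 : ℂ) ^ k • Complex.I • B)
  have key : ∀ k x, K k (G x) = G (L k x) := by
    intro k
    induction k with
    | zero =>
      intro x
      have hL0 : L 0 = NormedSpace.exp (Complex.I • B) := by simp [L]
      rw [hL0, h0]
    | succ k ih =>
      have hLb : ‖L (k + 1) - 1‖ ≤ 1 / 9 := by
        have hS : IsSelfAdjoint (((1 / 2 : ℝ) ^ (k + 1)) • B) := (IsSelfAdjoint.all _).smul hB
        have hSn : ‖((1 / 2 : ℝ) ^ (k + 1)) • B‖ ≤ 1 / 9 := by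
          rw [norm_smul, norm_pow]
          have : ‖(1 / 2 : ℝ)‖ ^ (k + 1) ≤ 1 := pow_le_one₀ (norm_nonneg _) (by norm_num)
          nlinarith [norm_nonneg B]
        -- The scalar is moved inside as a real number, so that what `i` multiplies is self-adjoint.
        have e : L (k + 1) = NormedSpace.exp (Complex.I • ((1 / 2 : ℝ) ^ (k + 1)) • B) := by
          simp only [L]
          rw [smul_comm, ← Complex.coe_smul]
          push_cast
          rfl
        rw [e]
        exact (norm_exp_I_smul_sub_one_le hS (by linarith [Real.pi_gt_three])).trans hSn
      -- Only indices `k + 1 ≥ 1` occur, so the distance `π / 2 ^ (k + 1)` is at most `π / 2`. At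
      -- index `0` the bound `π` would be too weak, but there the intertwining is the hypothesis
      -- `h0`.
      refine intertwine_of_sq (a := Real.pi / 2) (b := 1 / 9) (K (k + 1)) (L (k + 1)) G
        (by positivity) (fun y => ?_) hLb
        (by linarith [Real.pi_lt_d2]) fun x => ?_
      · refine (hb (k + 1) y).trans ?_
        have : (2 : ℝ) ≤ 2 ^ (k + 1) := by
          rw [pow_succ]
          linarith [one_le_pow₀ (M₀ := ℝ) (a := 2) (n := k) (by norm_num)]
        gcongr
      · rw [hK]
        have e : L (k + 1) (L (k + 1) x) = L k x :=
          congrArg (fun T : H →L[ℂ] H => T x) (exp_half_pow_succ_mul_self (Complex.I • B) k)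
        rw [e]
        exact ih x
  have t1 : Tendsto (fun k : ℕ => (2 : ℂ) ^ k • (K k (G x) - G x)) atTop
      (𝓝 (G ((Complex.I • B) x))) := by
    have hc : Continuous fun T : H →L[ℂ] H => G (T x) := by fun_prop
    refine ((hc.tendsto _).comp (tendsto_two_pow_smul_exp_sub_one (Complex.I • B))).congr
      fun k => ?_
    rw [key, ← map_sub, ← map_smul]
    rfl
  have e := tendsto_nhds_unique (hC (G x)) t1
  rw [smul_apply, map_smul] at e
  exact smul_right_injective _ Complex.I_ne_zero e

theorem map_argOp_embedding {H : Type*} [NormedAddCommGroup H] [InnerProductSpace ℂ H]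
    [CompleteSpace H] (B : H →L[ℂ] H) (hB : IsSelfAdjoint B) (hBnorm : ‖B‖ < 1 / 9)
    (A : H →L[ℂ] H) (hA : A = NormedSpace.exp (Complex.I • B))
    (φ : H) (hcyc : IsCyclicVector A φ) (D : Ultrafilter ℕ) (hD : IsSquareDivisible D)
    (U : ∀ N, complMinus A φ N ≃ₗᵢ[ℂ] complPlus A φ N)
    (u : ∀ N, OrthonormalBasis (Fin (Module.finrank ℂ (approxSpace A φ N))) ℂ (approxSpace A φ N))
    (l : ∀ N, Fin (Module.finrank ℂ (approxSpace A φ N)) → ℂ)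
    (hl : ∀ N n, approxOp A φ N (U N) (u N n) = l N n • u N n)
    (hT : ∃ C : ℝ, ∀ N x, ‖argOp (u N) (l N) x‖ ≤ C * ‖x‖) (x : H) :
    MetricUltraproduct.map (D := D) (fun N => argOp (u N) (l N)) hT (embedding A φ hcyc D hD x) =
      embedding A φ hcyc D hD (B x) := by
  have hAn : ∀ x, ‖A x‖ = ‖x‖ := fun x => hA ▸ norm_exp_I_smul_apply hB x
  refine intertwine_of_roots B hB hBnorm.le (embedding A φ hcyc D hD).toContinuousLinearMap
    (rootMap D u l) _ (fun x => ?_) (rootMap_succ_rootMap_succ u l) (norm_rootMap_sub_le u l)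
    (tendsto_two_pow_smul_rootMap_sub u l hT) x
  -- The eigenvalues have modulus `1`, so each equals `exp (i arg)` and the root of order `2 ^ 0` is
  -- `A_N` itself.
  have hop : ∀ N, rootOp (u N) (l N) 0 = approxOp A φ N (U N) := by
    intro N
    refine (eq_diagOp _ _ _ fun n => ?_).symm
    have hn := norm_eigenvalue_approxOp A hAn φ N (U N) ((u N).orthonormal.ne_zero n) (hl N n)
    rw [hl, pow_zero, div_one, mul_comm]
    congr 1
    simpa [hn] using (Complex.norm_mul_exp_arg_mul_I (l N n)).symm
  have hb : ∃ C : ℝ, ∀ N y, ‖approxOp A φ N (U N) y‖ ≤ C * ‖y‖ :=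
    ⟨1, fun N y => by rw [norm_approxOp A hAn, one_mul]⟩
  have e := map_approxOp_embedding A φ hcyc D hD U hb x
  rw [← hA]
  refine Eq.trans ?_ e
  simp only [rootMap, hop]
  rfl

theorem theorem3p3 {H : Type*} [NormedAddCommGroup H] [InnerProductSpace ℂ H] [CompleteSpace H]
    [TopologicalSpace.SeparableSpace H]
    (B : H →L[ℂ] H) (hB : IsSelfAdjoint B) (hBnorm : ‖B‖ < 1 / 9)
    (A : H →L[ℂ] H) (hA : A = NormedSpace.exp (Complex.I • B))
    (φ : H) (hφ : ‖φ‖ = 1) (hcyc : IsCyclicVector A φ)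
    (D : Ultrafilter ℕ) (hD : IsSquareDivisible D)
    (U : ∀ N, complMinus A φ N ≃ₗᵢ[ℂ] complPlus A φ N)
    (u : ∀ N, OrthonormalBasis (Fin (Module.finrank ℂ (approxSpace A φ N))) ℂ (approxSpace A φ N))
    (l : ∀ N, Fin (Module.finrank ℂ (approxSpace A φ N)) → ℂ)
    (hl : ∀ N n, approxOp A φ N (U N) (u N n) = l N n • u N n) :
    let Gm := embedding A φ hcyc D hD
    let HIm := LinearMap.range Gm.toLinearMap
    let Bm := MetricUltraproduct.map (D := D) (fun N => argOp (u N) (l N))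
      ⟨Real.pi, fun N => norm_argOp_le (u N) (l N)⟩
    ∃ closed : ∀ x ∈ HIm, Bm x ∈ HIm,
      Bm.toLinearMap.restrict closed =
        Gm.equivRange.toLinearEquiv.toLinearMap ∘ₗ B.toLinearMap ∘ₗ
          Gm.equivRange.symm.toLinearEquiv.toLinearMap := by
  intro Gm HIm Bm
  have h : ∀ x, Bm (Gm x) = Gm (B x) :=
    map_argOp_embedding B hB hBnorm A hA φ hcyc D hD U u l hl _
  refine ⟨?_, ?_⟩
  · rintro _ ⟨x, rfl⟩
    exact ⟨B x, (h x).symm⟩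
  · refine LinearMap.ext fun y => Subtype.ext ?_
    obtain ⟨x, rfl⟩ := Gm.equivRange.surjective y
    change Bm (Gm x) = Gm (B (Gm.equivRange.symm (Gm.equivRange x)))
    rw [h, LinearIsometryEquiv.symm_apply_apply]
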